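/- **Setting.** Let $n_y,n_u,n_a,n_b\in\mathbb N$, let $\mathcal Y\subseteq\mathbb R^{n_y}$, $\mathcal U\subseteq\mathbb R^{n_u}$, and let $y_r\in\operatorname{int}\mathcal Y$, $u_r\in\operatorname{int}\mathcal U$. A state is $x=(y_0,\dots,y_{n_a},v_1,\dots,v_{n_b})$, where $y_i\in\mathbb R^{n_y}$ is the output $i$ steps ago and $v_i\in\mathbb R^{n_u}$ the input $i$ steps ago; $\mathcal X=\mathcal Y^{n_a+1}\times\mathcal U^{n_b}$ and $x_r=(y_r,\dots,y_r,u_r,\dots,u_r)$. The nominal learned NARX model is $$F(x,u)=\bigl(f(x,u),y_0,\dots,y_{n_a-1},u,v_1,\dots,v_{n_b-1}\bigr),\qquad f(x,u)=\sum_{m=1}^{M}\mu_m\,\phi_m(x,u),$$ with arbitrary basis functions $\phi_m$ and an arbitrary (posterior mean) weight vector $\mu\in\mathbb R^M$. The stage cost is $\ell(x,u)=\ell_s(x-x_r,u-u_r)+\ell_b(y_0)$, where $\ell_b=0$ on $\mathcal Y$ and $\ell_b(y)\ge\alpha_b(d(y,\mathcal Y))$ for all $y$, with $\alpha_b$ of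 class $\mathcal K$. For a terminal cost $V_f$ put $\Omega_\theta=\{x: V_f(x-x_r)\le\theta\}$. **Assumptions.** (A) There are a terminal controller $\kappa_f$, a terminal cost $V_f$ and $\vartheta>0$ such that $\Omega_\vartheta$ is a neighbourhood of $x_r$ and, for some $\alpha_1,\alpha_2\in\mathcal K_\infty$ and all $x\in\Omega_\vartheta$: $\alpha_1(\|x-x_r\|)\le V_f(x-x_r)\le\alpha_2(\|x-x_r\|)$; $V_f(F(x,\kappa_f(x))-x_r)-V_f(x-x_r)\le-\ell_s(x-x_r,\kappa_f(x)-u_r)$; and $\kappa_f(x)\in\mathcal U$. (B) $\ell(x_r,u_r)=0$, and for some $\alpha_y\in\mathcal K$, $\ell(x,u)\ge\alpha_y(\|x-x_r\|)$ for all $x\in\mathcal X$, $u\in\mathcal U$. **MPC problem.** Let $1\le N_c\le N_p$ and $\lambda\ge1$. For a state $x$ and free inputs $\hat u_0,\dots,\hat u_{N_c-1}$ let $\hat x_0=x$, $\hat u_j=\kappa_f(\hat x_j)$ for $N_c\le j<N_p$, and $\hat x_{j+1}=F(\hat x_j,\hat u_j)$. Minimize $$J_\lambda(x,\hat u)=\sum_{i=0}^{N_p-1}\ell(\hat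 x_i,\hat u_i)+\lambda V_f(\hat x_{N_p}-x_r)$$ subject to $\hat x_j\in\mathcal X$, $\hat u_j\in\mathcal U$ for $0\le j<N_p$ (no terminal constraint). Let $J^*_\lambda(x)$ be the infimum. A control law resulting from this problem on a set $S$ is any $\kappa$ such that, for each $x\in S$, $\kappa(x)$ is the first input of a minimizer at $x$. **Theorem.** Assume (A) and (B). Call $(\theta,d)$ a level pair if $0<\theta\le\vartheta$, $\Omega_\theta\subseteq\mathcal X$, $d>0$ and $\ell(x,u)\ge d$ for all $x\in\mathcal X\setminus\Omega_\theta$, $u\in\mathcal U$. Level pairs exist. For every level pair $(\theta,d)$, define for $\lambda\ge 1$ the region of feasibility without terminal constraint $$\mathcal X_{N_c,N_p}(\lambda)=\{x:\ \text{the MPC problem is feasible at }x\text{ and }J^*_\lambda(x)\le N_p d+\lambda\theta\}.$$ Then: 1. For every $\lambda\ge1$, $\Omega_\theta\subseteq\mathcal X_{N_c,N_p}(\lambda)$, and for every $x\in\mathcal X_{N_c,N_p}(\lambda)$ each minimizer at $x$ has terminal state $\hat x_{N_p}\in\Omega_\theta$. 2. For every $\lambda\ge1$ and every control law $\kappa$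 resulting from the MPC problem on $\mathcal X_{N_c,N_p}(\lambda)$, the closed loop $x_{k+1}=F(x_k,\kappa(x_k))$ is asymptotically stable on $\mathcal X_{N_c,N_p}(\lambda)$: this set is a positively invariant neighbourhood of the equilibrium $x_r$, $x_r$ is Lyapunov stable, and $x_k\to x_r$ for every $x_0\in\mathcal X_{N_c,N_p}(\lambda)$. 3. The region increases with $\lambda$: if $1\le\lambda_1\le\lambda_2$, then $\mathcal X_{N_c,N_p}(\lambda_1)\subseteq\mathcal X_{N_c,N_p}(\lambda_2)$. -/

import Mathlib

open Set Filter Topology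

noncomputable section

namespace NarxMPC

/-- Comparison functions of class `K` (as functions on the half-line `[0, ∞)`). -/
def IsClassK (α : ℝ → ℝ) : Prop :=
  ContinuousOn α (Ici 0) ∧ StrictMonoOn α (Ici 0) ∧ α 0 = 0

/-- Comparison functions of class `K∞`. -/
def IsClassKInfty (α : ℝ → ℝ) : Prop :=
  IsClassK α ∧ Tendsto α atTop atTop

/-- Measured outputs. -/
abbrev Output (ny : ℕ) := EuclideanSpace ℝ (Fin ny)

/-- Control inputs. -/
abbrev Input (nu : ℕ) := EuclideanSpace ℝ (Fin nu)

/-- NARX states `(y_k, …, y_{k-na}, u_{k-1}, …, u_{k-nb})`, with the Euclidean norm. -/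
abbrev State (ny nu na nb : ℕ) :=
  WithLp 2 (PiLp 2 (fun _ : Fin (na + 1) => Output ny) × PiLp 2 (fun _ : Fin nb => Input nu))

/-- The state with output history `y` (most recent first) and input history `u`. -/
def mkState {ny nu na nb : ℕ} (y : Fin (na + 1) → Output ny) (u : Fin nb → Input nu) :
    State ny nu na nb :=
  WithLp.toLp 2 (WithLp.toLp 2 y, WithLp.toLp 2 u)

/-- `outputs x i` is `y_{k-i}`. -/
def outputs {ny nu na nb : ℕ} (x : State ny nu na nb) : Fin (na + 1) → Output ny :=
  fun i => x.fst i

/-- `inputs x i` is `u_{k-1-i}`. -/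
def inputs {ny nu na nb : ℕ} (x : State ny nu na nb) : Fin nb → Input nu :=
  fun i => x.snd i

/-- Push a new most recent entry into a history of length `n` and drop the oldest one. -/
def push {E : Type*} {n : ℕ} (a : E) (v : Fin n → E) : Fin n → E :=
  fun i => (Fin.cons a v : Fin (n + 1) → E) i.castSucc

/-- The data of the predictive control problem (no property is assumed of them here). -/
structure Problem (ny nu na nb : ℕ) where
  /-- number of basis functions of the dictionary -/
  M : ℕ
  /-- the dictionary, evaluated at the regressor `(x, u)` -/
  φ : Fin M → State ny nu na nb → Input nu → Output ny
  /-- the learned (posterior mean) weights -/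
  μ : Fin M → ℝ
  /-- output constraint set -/
  Y : Set (Output ny)
  /-- input constraint set -/
  U : Set (Input nu)
  /-- reference output -/
  yr : Output ny
  /-- reference input -/
  ur : Input nu
  /-- tracking part of the stage cost, a function of the two deviations from the reference -/
  ls : State ny nu na nb → Input nu → ℝ
  /-- barrier part of the stage cost -/
  lb : Output ny → ℝ
  /-- terminal cost, a function of the deviation from the reference -/
  Vf : State ny nu na nb → ℝ
  /-- terminal controller -/
  κf : State ny nu na nb → Input nu
  /-- control horizon -/
  Nc : ℕ
  /-- prediction horizon -/
  Np : ℕ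

namespace Problem

variable {ny nu na nb : ℕ} (P : Problem ny nu na nb)

/-- Nominal one-step output prediction: the predictive mean `μᵀ Φ(x, u)`. -/
def f (x : State ny nu na nb) (u : Input nu) : Output ny :=
  ∑ m, P.μ m • P.φ m x u

/-- Nominal NARX state map. -/
def F (x : State ny nu na nb) (u : Input nu) : State ny nu na nb :=
  mkState (push (P.f x u) (outputs x)) (push u (inputs x))

/-- Reference state. -/
def xr : State ny nu na nb := mkState (fun _ => P.yr) (fun _ => P.ur)

/-- State constraint set `Y^(na+1) × U^nb`. -/
def X : Set (State ny nu na nb) :=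
  {x | (∀ i, outputs x i ∈ P.Y) ∧ ∀ i, inputs x i ∈ P.U}

/-- Stage cost. -/
def stageCost (x : State ny nu na nb) (u : Input nu) : ℝ :=
  P.ls (x - P.xr) (u - P.ur) + P.lb (outputs x 0)

/-- Sublevel set of the terminal cost around the reference. -/
def Ω (θ : ℝ) : Set (State ny nu na nb) := {x | P.Vf (x - P.xr) ≤ θ}

/-- `lb` is a barrier function for the output constraint set. -/
def IsBarrier : Prop :=
  (∀ y ∈ P.Y, P.lb y = 0) ∧
    ∃ α, IsClassK α ∧ ∀ y, α (Metric.infDist y P.Y) ≤ P.lb y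

/-- Local Lyapunov conditions on the terminal cost and the terminal controller. -/
def TerminalCondition (ϑ : ℝ) : Prop :=
  ∃ α₁ α₂, IsClassKInfty α₁ ∧ IsClassKInfty α₂ ∧ ∀ x ∈ P.Ω ϑ,
    α₁ ‖x - P.xr‖ ≤ P.Vf (x - P.xr) ∧ P.Vf (x - P.xr) ≤ α₂ ‖x - P.xr‖ ∧
    P.Vf (P.F x (P.κf x) - P.xr) - P.Vf (x - P.xr) ≤ -P.ls (x - P.xr) (P.κf x - P.ur) ∧
    P.κf x ∈ P.U

/-- Positive definiteness of the stage cost. -/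
def StageCostPosDef : Prop :=
  P.stageCost P.xr P.ur = 0 ∧
    ∃ α, IsClassK α ∧ ∀ x ∈ P.X, ∀ u ∈ P.U, α ‖x - P.xr‖ ≤ P.stageCost x u

/-- Predicted states from `x` under the decision `u`: the free moves are applied during the
control horizon and the terminal controller afterwards. -/
def pred (x : State ny nu na nb) (u : Fin P.Nc → Input nu) : ℕ → State ny nu na nb
  | 0 => x
  | j + 1 => P.F (pred x u j) (if h : j < P.Nc then u ⟨j, h⟩ else P.κf (pred x u j))

/-- The input that is applied at step `j` of the prediction. -/
def move (x : State ny nu na nb) (u : Fin P.Nc → Input nu) (j : ℕ) : Input nu :=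
  if h : j < P.Nc then u ⟨j, h⟩ else P.κf (P.pred x u j)

/-- Decisions that satisfy the state and input constraints (there is no terminal constraint). -/
def admissible (x : State ny nu na nb) : Set (Fin P.Nc → Input nu) :=
  {u | ∀ j < P.Np, P.pred x u j ∈ P.X ∧ P.move x u j ∈ P.U}

/-- Cost of a decision, with terminal weight `lam`. -/
def cost (lam : ℝ) (x : State ny nu na nb) (u : Fin P.Nc → Input nu) : ℝ :=
  ∑ i ∈ Finset.range P.Np, P.stageCost (P.pred x u i) (P.move x u i) +
    lam * P.Vf (P.pred x u P.Np - P.xr)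

/-- Solutions of the optimization problem at `x`. -/
def IsOptimal (lam : ℝ) (x : State ny nu na nb) (u : Fin P.Nc → Input nu) : Prop :=
  u ∈ P.admissible x ∧ ∀ v ∈ P.admissible x, P.cost lam x u ≤ P.cost lam x v

/-- `κ` is on `S` a control law that results from the optimization problem: it applies the first
move of a solution. -/
def IsMPCLawOn (lam : ℝ) (S : Set (State ny nu na nb)) (κ : State ny nu na nb → Input nu) : Prop :=
  ∀ x ∈ S, ∃ u, P.IsOptimal lam x u ∧ κ x = P.move x u 0

/-- Optimal value (used only where the problem is feasible). -/
def value (lam : ℝ) (x : State ny nu na nb) : ℝ :=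
  sInf (P.cost lam x '' P.admissible x)

/-- `θ` is a level of the terminal cost, not above `ϑ`, whose sublevel set respects the state
constraints, and `d` bounds the stage cost from below outside this sublevel set. -/
def LevelPair (ϑ θ d : ℝ) : Prop :=
  0 < θ ∧ θ ≤ ϑ ∧ P.Ω θ ⊆ P.X ∧ 0 < d ∧ ∀ x ∈ P.X \ P.Ω θ, ∀ u ∈ P.U, d ≤ P.stageCost x u

/-- The region of feasibility without terminal constraint. -/
def region (θ d lam : ℝ) : Set (State ny nu na nb) :=
  {x | (P.admissible x).Nonempty ∧ P.value lam x ≤ P.Np * d + lam * θ}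

end Problem

/-- The equilibrium `e` of `x⁺ = g x` is asymptotically stable, with `S` a positively invariant
neighbourhood of `e` that lies in the domain of attraction. -/
def AsymptoticallyStableOn {E : Type*} [PseudoMetricSpace E] (g : E → E) (e : E) (S : Set E) :
    Prop :=
  S ∈ 𝓝 e ∧ g e = e ∧ MapsTo g S S ∧
    (∀ ε > 0, ∃ δ > 0, ∀ x ∈ S, dist x e < δ → ∀ k : ℕ, dist (g^[k] x) e < ε) ∧
    ∀ x ∈ S, Tendsto (fun k : ℕ => g^[k] x) atTop (𝓝 e)

end NarxMPC

end

namespace NarxMPC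

/-! On `Ω θ` the terminal controller pays for its own stage costs out of `Vf`, and `1 ≤ lam` keeps
this true for the weighted terminal cost. Hence a prediction that meets `Ω θ` before the end can be
completed by the terminal controller at no extra cost (`exists_switch`), and strictly more cheaply
if it originally ended outside. A prediction that ends outside and never meets `Ω θ` costs at least
`Np * d + lam * Vf`, with `Vf > θ` at its end. This dichotomy, `exists_improvement_or_le_cost`, is
the core: below the threshold `Np * d + lam * θ`, optimal predictions end in `Ω θ` without being
forced to.

The usual shift argument then applies (`value_F_le`): the optimal value drops by at least the stage
cost and is a Lyapunov function. Monotonicity in the weight uses the same dichotomy on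
near-minimizers, as the infimum need not be attained. -/

/-! ### Class K functions and a Lyapunov criterion -/

theorem IsClassK.nonneg {α : ℝ → ℝ} (h : IsClassK α) {r : ℝ} (hr : 0 ≤ r) : 0 ≤ α r := by
  have := h.2.1.monotoneOn (mem_Ici.2 le_rfl) (mem_Ici.2 hr) hr
  rwa [h.2.2] at this

theorem IsClassK.pos {α : ℝ → ℝ} (h : IsClassK α) {r : ℝ} (hr : 0 < r) : 0 < α r := by
  have := h.2.1 (mem_Ici.2 le_rfl) (mem_Ici.2 hr.le) hr
  rwa [h.2.2] at this

theorem IsClassK.lt_of_lt {α : ℝ → ℝ} (h : IsClassK α) {r s : ℝ} (hr : 0 ≤ r) (hs : 0 ≤ s)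
    (hrs : α r < α s) : r < s :=
  (h.2.1.lt_iff_lt (mem_Ici.2 hr) (mem_Ici.2 hs)).1 hrs

theorem IsClassK.eventually_lt {α : ℝ → ℝ} (h : IsClassK α) {E : Type*} [PseudoMetricSpace E]
    (e : E) {ε : ℝ} (hε : 0 < ε) : ∀ᶠ x in 𝓝 e, α (dist x e) < ε := by
  have hα : Tendsto α (𝓝[Ici 0] 0) (𝓝 0) := by
    have := h.1 0 (mem_Ici.2 le_rfl)
    rwa [ContinuousWithinAt, h.2.2] at this
  have hd : Tendsto (fun x => dist x e) (𝓝 e) (𝓝[Ici 0] 0) := by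
    refine tendsto_nhdsWithin_iff.2 ⟨?_, Eventually.of_forall fun x => dist_nonneg⟩
    simpa using (continuous_id.dist continuous_const : Continuous fun x : E => dist x e).tendsto e
  exact (hα.comp hd).eventually (gt_mem_nhds hε)

/-- A Lyapunov criterion for asymptotic stability. -/
theorem asymptoticallyStableOn_of_lyapunov {E : Type*} [MetricSpace E] {g : E → E} {e : E}
    {S : Set E} (hS : S ∈ 𝓝 e) (hmaps : MapsTo g S S) {V : E → ℝ} {α : ℝ → ℝ} (hα : IsClassK α)
    (hlow : ∀ x ∈ S, α (dist x e) ≤ V x) (hdec : ∀ x ∈ S, V (g x) + α (dist x e) ≤ V x)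
    (hup : ∀ ε > 0, ∀ᶠ x in 𝓝 e, V x < ε) : AsymptoticallyStableOn g e S := by
  have hiter : ∀ x ∈ S, ∀ k, g^[k] x ∈ S := fun x hx k => hmaps.iterate k hx
  have hle : ∀ x ∈ S, V (g x) ≤ V x := fun x hx => by
    linarith [hdec x hx, hα.nonneg (dist_nonneg (x := x) (y := e))]
  have hanti : ∀ x ∈ S, ∀ k, V (g^[k] x) ≤ V x := by
    intro x hx k
    induction k with
    | zero => simp
    | succ k ih =>
      rw [Function.iterate_succ_apply']
      exact (hle _ (hiter x hx k)).trans ih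
  refine ⟨hS, ?_, hmaps, ?_, ?_⟩
  · have heS : e ∈ S := mem_of_mem_nhds hS
    by_contra hne
    -- `hup` at `e` itself puts `V e` below every positive number, whereas `V e ≥ V (g e) ≥ α (dist
    -- (g e) e)`.
    have hpos := hα.pos (dist_pos.2 hne)
    have h1 := (hup _ hpos).self_of_nhds
    linarith [hlow _ (hmaps heS), hle e heS]
  · intro ε hε
    obtain ⟨δ, hδ, h⟩ := Metric.eventually_nhds_iff.1 (hup _ (hα.pos hε))
    refine ⟨δ, hδ, fun x hx hxe k => hα.lt_of_lt dist_nonneg hε.le ?_⟩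
    linarith [hlow _ (hiter x hx k), hanti x hx k, h hxe]
  · intro x hx
    -- The decrease telescopes, so the dissipation is summable and its terms tend to zero; neither
    -- continuity of `V` nor compactness is needed.
    have hsum : ∀ n, ∑ k ∈ Finset.range n, α (dist (g^[k] x) e) ≤ V x := by
      suffices ∀ n, ∑ k ∈ Finset.range n, α (dist (g^[k] x) e) + V (g^[n] x) ≤ V x by
        intro n
        linarith [this n, hlow _ (hiter x hx n),
          hα.nonneg (dist_nonneg (x := g^[n] x) (y := e))]
      intro n
      induction n with
      | zero => simp
      | succ n ih =>
        rw [Finset.sum_range_succ, Function.iterate_succ_apply']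
        linarith [hdec _ (hiter x hx n)]
    have hlim := (summable_of_sum_range_le (fun n => hα.nonneg dist_nonneg)
      hsum).tendsto_atTop_zero
    rw [Metric.tendsto_nhds]
    intro ε hε
    filter_upwards [hlim.eventually (gt_mem_nhds (hα.pos hε))] with k hk
    exact hα.lt_of_lt dist_nonneg hε.le hk

namespace Problem

variable {ny nu na nb : ℕ} (P : Problem ny nu na nb)

/-! ### Predictions and elementary cost bounds -/

theorem pred_succ (x : State ny nu na nb) (u : Fin P.Nc → Input nu) (j : ℕ) :
    P.pred x u (j + 1) = P.F (P.pred x u j) (P.move x u j) := rfl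

theorem move_of_le (x : State ny nu na nb) (u : Fin P.Nc → Input nu) {j : ℕ} (h : P.Nc ≤ j) :
    P.move x u j = P.κf (P.pred x u j) := by
  simp [move, Nat.not_lt.2 h]

/-- A trajectory that is governed by the terminal controller after the control horizon is a
prediction. -/
theorem pred_move_eq {xs : ℕ → State ny nu na nb} {us : ℕ → Input nu}
    (hstep : ∀ j, xs (j + 1) = P.F (xs j) (us j)) (hκ : ∀ j, P.Nc ≤ j → us j = P.κf (xs j))
    (j : ℕ) :
    P.pred (xs 0) (fun i => us i) j = xs j ∧ P.move (xs 0) (fun i => us i) j = us j := by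
  have hmove : ∀ j, P.pred (xs 0) (fun i => us i) j = xs j →
      P.move (xs 0) (fun i => us i) j = us j := by
    intro j hj
    by_cases h : j < P.Nc
    · simp [move, h]
    · rw [P.move_of_le _ _ (not_lt.1 h), hj, hκ j (not_lt.1 h)]
  have hpred : P.pred (xs 0) (fun i => us i) j = xs j := by
    induction j with
    | zero => rfl
    | succ j ih => rw [pred_succ, hmove j ih, ih, hstep]
  exact ⟨hpred, hmove j hpred⟩

/-- One step of the terminal controller. -/
def terminalStep (x : State ny nu na nb) : State ny nu na nb := P.F x (P.κf x)

/-- The terminal controller decreases the terminal cost on `S` by at least the stage cost, and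
it respects the input constraints there. -/
def TerminalDecrease (S : Set (State ny nu na nb)) : Prop :=
  ∀ x ∈ S, P.Vf (P.terminalStep x - P.xr) + P.stageCost x (P.κf x) ≤ P.Vf (x - P.xr) ∧
    P.κf x ∈ P.U

/-- The stage cost is nonnegative under the constraints, the terminal cost everywhere. -/
def NonnegCosts : Prop :=
  (∀ x ∈ P.X, ∀ u ∈ P.U, 0 ≤ P.stageCost x u) ∧ ∀ x, 0 ≤ P.Vf (x - P.xr)

variable {P}

/-- Nonnegative stage costs make the sublevel set invariant, and the one-step decreases telescope.
-/
theorem terminalStep_iterate {θ : ℝ} (hX : P.Ω θ ⊆ P.X) (hN : P.NonnegCosts)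
    (hD : P.TerminalDecrease (P.Ω θ)) {z : State ny nu na nb} (hz : z ∈ P.Ω θ) (n : ℕ) :
    P.terminalStep^[n] z ∈ P.Ω θ ∧
      ∑ i ∈ Finset.range n, P.stageCost (P.terminalStep^[i] z) (P.κf (P.terminalStep^[i] z)) +
        P.Vf (P.terminalStep^[n] z - P.xr) ≤ P.Vf (z - P.xr) := by
  induction n with
  | zero => simpa using hz
  | succ n ih =>
    obtain ⟨hmem, hsum⟩ := ih
    obtain ⟨hdec, hU⟩ := hD _ hmem
    have h0 := hN.1 _ (hX hmem) _ hU
    rw [Finset.sum_range_succ, Function.iterate_succ_apply']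
    refine ⟨?_, by linarith⟩
    have : P.Vf (P.terminalStep^[n] z - P.xr) ≤ θ := hmem
    exact (by linarith : P.Vf (P.terminalStep (P.terminalStep^[n] z) - P.xr) ≤ θ)

theorem cost_nonneg (hN : P.NonnegCosts) {lam : ℝ} (hlam : 1 ≤ lam) {x : State ny nu na nb}
    {u : Fin P.Nc → Input nu} (hu : u ∈ P.admissible x) : 0 ≤ P.cost lam x u := by
  refine add_nonneg (Finset.sum_nonneg fun i hi => ?_) (mul_nonneg (by linarith) (hN.2 _))
  have := hu i (Finset.mem_range.1 hi)
  exact hN.1 _ this.1 _ this.2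

theorem bddBelow_cost (hN : P.NonnegCosts) {lam : ℝ} (hlam : 1 ≤ lam) (x : State ny nu na nb) :
    BddBelow (P.cost lam x '' P.admissible x) :=
  ⟨0, by rintro _ ⟨u, hu, rfl⟩; exact cost_nonneg hN hlam hu⟩

theorem value_le_cost (hN : P.NonnegCosts) {lam : ℝ} (hlam : 1 ≤ lam) {x : State ny nu na nb}
    {u : Fin P.Nc → Input nu} (hu : u ∈ P.admissible x) : P.value lam x ≤ P.cost lam x u :=
  csInf_le (bddBelow_cost hN hlam x) (mem_image_of_mem _ hu)

theorem IsOptimal.cost_eq_value (hN : P.NonnegCosts) {lam : ℝ} (hlam : 1 ≤ lam)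
    {x : State ny nu na nb} {u : Fin P.Nc → Input nu} (hu : P.IsOptimal lam x u) :
    P.cost lam x u = P.value lam x := by
  refine le_antisymm (le_csInf ⟨_, mem_image_of_mem _ hu.1⟩ ?_) (value_le_cost hN hlam hu.1)
  rintro _ ⟨v, hv, rfl⟩
  exact hu.2 v hv

/-! ### Switching to the terminal controller, and the cost dichotomy -/

/-- Switching to the terminal controller as soon as the prediction is in the terminal set. -/
theorem exists_switch {θ : ℝ} (hX : P.Ω θ ⊆ P.X) (hN : P.NonnegCosts)
    (hD : P.TerminalDecrease (P.Ω θ)) {lam : ℝ} (hlam : 1 ≤ lam) {x : State ny nu na nb}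
    {u : Fin P.Nc → Input nu} {j : ℕ} (hj : j ≤ P.Np)
    (hu : ∀ i < j, P.pred x u i ∈ P.X ∧ P.move x u i ∈ P.U) (hmem : P.pred x u j ∈ P.Ω θ) :
    ∃ v ∈ P.admissible x, P.pred x v P.Np ∈ P.Ω θ ∧
      P.cost lam x v ≤ ∑ i ∈ Finset.range j, P.stageCost (P.pred x u i) (P.move x u i) +
        lam * P.Vf (P.pred x u j - P.xr) := by
  -- The glued trajectory obeys the terminal controller from `Nc` on, whether `j` comes before or
  -- after `Nc`, so it is the prediction of its first `Nc` inputs.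
  set xs : ℕ → State ny nu na nb :=
    fun i => if i ≤ j then P.pred x u i else P.terminalStep^[i - j] (P.pred x u j) with hxs
  set us : ℕ → Input nu := fun i => if i < j then P.move x u i else P.κf (xs i) with hus
  have hxs_add : ∀ i, xs (j + i) = P.terminalStep^[i] (P.pred x u j) := by
    intro i
    rcases Nat.eq_zero_or_pos i with rfl | hi
    · simp [hxs]
    · simp [hxs, hi.ne']
  have hxs_le : ∀ i ≤ j, xs i = P.pred x u i := fun i hi => by simp [hxs, hi]
  have hus_lt : ∀ i < j, us i = P.move x u i := fun i hi => by simp [hus, hi]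
  have hus_add : ∀ i, us (j + i) = P.κf (P.terminalStep^[i] (P.pred x u j)) := fun i => by
    simp [hus, ← hxs_add]
  have hstep : ∀ i, xs (i + 1) = P.F (xs i) (us i) := by
    intro i
    rcases lt_or_ge i j with hi | hi
    · rw [hxs_le _ hi, hxs_le _ hi.le, hus_lt _ hi, pred_succ]
    · obtain ⟨k, rfl⟩ := Nat.exists_eq_add_of_le hi
      rw [add_assoc, hxs_add, hxs_add, hus_add, Function.iterate_succ_apply']
      rfl
  have hκ : ∀ i, P.Nc ≤ i → us i = P.κf (xs i) := by
    intro i hi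
    rcases lt_or_ge i j with hij | hij
    · rw [hus_lt _ hij, hxs_le _ hij.le, P.move_of_le _ _ hi]
    · simp [hus, not_lt.2 hij]
  have hx0 : xs 0 = x := hxs_le 0 (Nat.zero_le _)
  have hpm := P.pred_move_eq hstep hκ
  rw [hx0] at hpm
  have hit := terminalStep_iterate hX hN hD hmem
  obtain ⟨n, hn⟩ := Nat.exists_eq_add_of_le hj
  refine ⟨fun i => us i, ?_, ?_, ?_⟩
  · intro i _
    rw [(hpm i).1, (hpm i).2]
    rcases lt_or_ge i j with hij | hij
    · rw [hxs_le _ hij.le, hus_lt _ hij]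
      exact hu i hij
    · obtain ⟨k, rfl⟩ := Nat.exists_eq_add_of_le hij
      rw [hxs_add, hus_add]
      exact ⟨hX (hit k).1, (hD _ (hit k).1).2⟩
  · rw [(hpm _).1, hn, hxs_add]
    exact (hit n).1
  · have hcost : P.cost lam x (fun i => us i) =
        ∑ i ∈ Finset.range j, P.stageCost (P.pred x u i) (P.move x u i) +
        ∑ i ∈ Finset.range n, P.stageCost (P.terminalStep^[i] (P.pred x u j))
          (P.κf (P.terminalStep^[i] (P.pred x u j))) +
        lam * P.Vf (P.terminalStep^[n] (P.pred x u j) - P.xr) := by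
      rw [cost, (hpm _).1]
      simp only [fun i => (hpm i).1, fun i => (hpm i).2]
      rw [hn, Finset.sum_range_add, hxs_add]
      congr 2
      · refine Finset.sum_congr rfl fun i hi => ?_
        have hi := Finset.mem_range.1 hi
        rw [hxs_le _ hi.le, hus_lt _ hi]
      · refine Finset.sum_congr rfl fun i _ => ?_
        rw [hxs_add, hus_add]
    have hsum := (hit n).2
    have hnn : 0 ≤ ∑ i ∈ Finset.range n, P.stageCost (P.terminalStep^[i] (P.pred x u j))
        (P.κf (P.terminalStep^[i] (P.pred x u j))) :=
      Finset.sum_nonneg fun i _ => hN.1 _ (hX (hit i).1) _ (hD _ (hit i).1).2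
    have hle : P.Vf (P.terminalStep^[n] (P.pred x u j) - P.xr) ≤
        P.Vf (P.pred x u j - P.xr) := by linarith
    -- The telescoped bound covers weight one; the remaining weight `lam - 1 ≥ 0` only needs `Vf`
    -- not to increase.
    have := mul_le_mul_of_nonneg_left hle (sub_nonneg.2 hlam)
    rw [hcost]
    linarith

/-- A decision with terminal state outside the terminal set can be improved to one that ends in
the terminal set, unless its prediction avoids the terminal set altogether. -/
theorem exists_improvement_or_le_cost {θ d : ℝ} (hX : P.Ω θ ⊆ P.X) (hN : P.NonnegCosts)
    (hD : P.TerminalDecrease (P.Ω θ))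
    (hd : ∀ x ∈ P.X \ P.Ω θ, ∀ u ∈ P.U, d ≤ P.stageCost x u)
    {lam : ℝ} (hlam : 1 ≤ lam) {x : State ny nu na nb} {u : Fin P.Nc → Input nu}
    (hu : u ∈ P.admissible x) (hend : P.pred x u P.Np ∉ P.Ω θ) :
    (∃ v ∈ P.admissible x, P.pred x v P.Np ∈ P.Ω θ ∧ P.cost lam x v < P.cost lam x u) ∨
      P.Np * d + lam * P.Vf (P.pred x u P.Np - P.xr) ≤ P.cost lam x u := by
  by_cases h : ∃ j < P.Np, P.pred x u j ∈ P.Ω θ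
  · obtain ⟨j, hj, hmem⟩ := h
    obtain ⟨v, hv, hvend, hcost⟩ := exists_switch hX hN hD hlam hj.le
      (fun i hi => hu i (hi.trans hj)) hmem
    refine Or.inl ⟨v, hv, hvend, hcost.trans_lt ?_⟩
    -- The strict gain is in the terminal term: `Vf` is at most `θ` at step `j` and above `θ` at the
    -- end.
    refine add_lt_add_of_le_of_lt ?_ ?_
    · refine Finset.sum_le_sum_of_subset_of_nonneg (Finset.range_mono hj.le) fun i hi _ => ?_
      have := hu i (Finset.mem_range.1 hi)
      exact hN.1 _ this.1 _ this.2
    · refine mul_lt_mul_of_pos_left ?_ (by linarith)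
      exact lt_of_le_of_lt hmem (not_le.1 hend)
  · push Not at h
    refine Or.inr (add_le_add ?_ le_rfl)
    have := Finset.card_nsmul_le_sum (Finset.range P.Np)
      (fun i => P.stageCost (P.pred x u i) (P.move x u i)) d fun i hi => by
        have hi := Finset.mem_range.1 hi
        exact hd _ ⟨(hu i hi).1, h i hi⟩ _ (hu i hi).2
    simpa using this

theorem mem_Ω_of_isOptimal {θ d : ℝ} (hX : P.Ω θ ⊆ P.X) (hN : P.NonnegCosts)
    (hD : P.TerminalDecrease (P.Ω θ))
    (hd : ∀ x ∈ P.X \ P.Ω θ, ∀ u ∈ P.U, d ≤ P.stageCost x u)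
    {lam : ℝ} (hlam : 1 ≤ lam) {x : State ny nu na nb} (hx : x ∈ P.region θ d lam)
    {u : Fin P.Nc → Input nu} (hu : P.IsOptimal lam x u) : P.pred x u P.Np ∈ P.Ω θ := by
  by_contra hend
  rcases exists_improvement_or_le_cost hX hN hD hd hlam hu.1 hend with ⟨v, hv, -, hlt⟩ | hle
  · exact (hu.2 v hv).not_gt hlt
  · have h1 : θ < P.Vf (P.pred x u P.Np - P.xr) := not_le.1 hend
    have h2 := mul_lt_mul_of_pos_left h1 (by linarith : 0 < lam)
    linarith [hx.2, hu.cost_eq_value hN hlam]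

theorem value_le_of_mem_Ω {θ : ℝ} (hX : P.Ω θ ⊆ P.X) (hN : P.NonnegCosts)
    (hD : P.TerminalDecrease (P.Ω θ)) {lam : ℝ} (hlam : 1 ≤ lam) {x : State ny nu na nb}
    (hx : x ∈ P.Ω θ) :
    (P.admissible x).Nonempty ∧ P.value lam x ≤ lam * P.Vf (x - P.xr) := by
  obtain ⟨v, hv, -, hcost⟩ := exists_switch (x := x) (u := fun _ => 0) (j := 0) hX hN hD hlam
    (Nat.zero_le _) (by simp) hx
  refine ⟨⟨v, hv⟩, (value_le_cost hN hlam hv).trans (hcost.trans_eq ?_)⟩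
  simp [pred]

/-! ### Lyapunov bounds on the optimal value -/

/-- The optimal value decreases along the closed loop by at least the stage cost. -/
theorem value_F_le (hNp : P.Nc ≤ P.Np) {θ : ℝ} (hX : P.Ω θ ⊆ P.X)
    (hN : P.NonnegCosts) (hD : P.TerminalDecrease (P.Ω θ)) {lam : ℝ} (hlam : 1 ≤ lam)
    {x : State ny nu na nb} {u : Fin P.Nc → Input nu} (hu : P.IsOptimal lam x u)
    (hend : P.pred x u P.Np ∈ P.Ω θ) :
    (P.admissible (P.F x (P.move x u 0))).Nonempty ∧
      P.value lam (P.F x (P.move x u 0)) + P.stageCost x (P.move x u 0) ≤ P.value lam x := by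
  -- The shifted prediction is again a prediction; its last input is `move` at `Np`, a
  -- terminal-controller input because `Nc ≤ Np`.
  have hpm := P.pred_move_eq (xs := fun i => P.pred x u (i + 1))
    (us := fun i => P.move x u (i + 1)) (fun i => rfl)
    (fun i hi => P.move_of_le _ _ (hi.trans (Nat.le_succ i)))
  have hx0 : P.pred x u (0 + 1) = P.F x (P.move x u 0) := rfl
  have hlast : P.move x u P.Np = P.κf (P.pred x u P.Np) := P.move_of_le _ _ hNp
  obtain ⟨hdec, hκU⟩ := hD _ hend
  simp only [hx0] at hpm
  have hadm : (fun i : Fin P.Nc => P.move x u (i + 1)) ∈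
      P.admissible (P.F x (P.move x u 0)) := by
    intro i hi
    rw [(hpm i).1, (hpm i).2]
    rcases (Nat.succ_le_of_lt hi).lt_or_eq with h | h
    · exact hu.1 _ h
    · rw [← Nat.succ_eq_add_one, h, hlast]
      exact ⟨hX hend, hκU⟩
  refine ⟨⟨_, hadm⟩, ?_⟩
  have hle := value_le_cost hN hlam hadm
  have hcost : P.cost lam (P.F x (P.move x u 0)) (fun i => P.move x u (i + 1)) +
      P.stageCost x (P.move x u 0) =
      ∑ i ∈ Finset.range P.Np, P.stageCost (P.pred x u i) (P.move x u i) +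
        P.stageCost (P.pred x u P.Np) (P.κf (P.pred x u P.Np)) +
        lam * P.Vf (P.terminalStep (P.pred x u P.Np) - P.xr) := by
    rw [cost, (hpm _).1]
    simp only [fun i => (hpm i).1, fun i => (hpm i).2]
    rw [pred_succ, hlast, ← hlast, ← Finset.sum_range_succ
      (fun i => P.stageCost (P.pred x u i) (P.move x u i)), Finset.sum_range_succ', hlast]
    simp only [pred, terminalStep]
    ring
  have hopt := hu.cost_eq_value hN hlam
  rw [cost] at hopt
  have h0 := hN.1 _ (hX hend) _ hκU
  have h1 := mul_le_mul_of_nonneg_left hdec (by linarith : 0 ≤ lam)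
  have h2 := mul_le_mul_of_nonneg_right hlam h0
  linarith

theorem le_value (hNp : 1 ≤ P.Np) (hN : P.NonnegCosts) {α : ℝ → ℝ}
    (hα : ∀ x ∈ P.X, ∀ u ∈ P.U, α ‖x - P.xr‖ ≤ P.stageCost x u) {lam : ℝ} (hlam : 1 ≤ lam)
    {x : State ny nu na nb} (hx : (P.admissible x).Nonempty) :
    α ‖x - P.xr‖ ≤ P.value lam x := by
  refine le_csInf (hx.image _) ?_
  rintro _ ⟨u, hu, rfl⟩
  have h0 := hu 0 hNp
  have h1 := Finset.single_le_sum (f := fun i => P.stageCost (P.pred x u i) (P.move x u i))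
    (fun i hi => hN.1 _ (hu i (Finset.mem_range.1 hi)).1 _ (hu i (Finset.mem_range.1 hi)).2)
    (Finset.mem_range.2 hNp)
  have h2 := mul_nonneg (by linarith : 0 ≤ lam) (hN.2 (P.pred x u P.Np))
  have h3 := hα _ h0.1 _ h0.2
  rw [cost]
  simp only [pred] at h1 h3
  linarith

/-! ### Monotonicity in the terminal weight -/

theorem region_mono {θ d : ℝ} (hX : P.Ω θ ⊆ P.X) (hN : P.NonnegCosts)
    (hD : P.TerminalDecrease (P.Ω θ))
    (hd : ∀ x ∈ P.X \ P.Ω θ, ∀ u ∈ P.U, d ≤ P.stageCost x u)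
    {lam₁ lam₂ : ℝ} (h₁ : 1 ≤ lam₁) (h₁₂ : lam₁ ≤ lam₂) :
    P.region θ d lam₁ ⊆ P.region θ d lam₂ := by
  intro x hx
  refine ⟨hx.1, ?_⟩
  have hpos : 0 < lam₁ := by linarith
  have hcost : ∀ u, P.cost lam₂ x u =
      P.cost lam₁ x u + (lam₂ - lam₁) * P.Vf (P.pred x u P.Np - P.xr) := by
    intro u
    simp only [cost]
    ring
  have hin : ∀ c, ∀ v ∈ P.admissible x, P.cost lam₁ x v ≤ c → ∀ η,
      P.Vf (P.pred x v P.Np - P.xr) ≤ η → P.value lam₂ x ≤ c + (lam₂ - lam₁) * η := by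
    intro c v hv hc η hη
    refine (value_le_cost hN (h₁.trans h₁₂) hv).trans ?_
    rw [hcost]
    exact add_le_add hc (mul_le_mul_of_nonneg_left hη (sub_nonneg.2 h₁₂))
  have key : ∀ ε > 0, P.value lam₂ x ≤
      P.Np * d + lam₁ * θ + lam₁ * ε + (lam₂ - lam₁) * (θ + ε) := by
    intro ε hε
    have hlt : P.value lam₁ x < P.Np * d + lam₁ * θ + lam₁ * ε := by
      linarith [hx.2, mul_pos hpos hε]
    obtain ⟨_, ⟨u, hu, rfl⟩, huc⟩ := exists_lt_of_csInf_lt (hx.1.image _) hlt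
    by_cases hend : P.pred x u P.Np ∈ P.Ω θ
    · have : P.Vf (P.pred x u P.Np - P.xr) ≤ θ := hend
      exact hin _ u hu huc.le _ (by linarith)
    rcases exists_improvement_or_le_cost hX hN hD hd h₁ hu hend with ⟨v, hv, hvend, hvc⟩ | hle
    · have : P.Vf (P.pred x v P.Np - P.xr) ≤ θ := hvend
      exact hin _ v hv (hvc.trans huc).le _ (by linarith)
    -- Comparing `Np * d + lam₁ * Vf` with the cost bound and dividing by `lam₁` gives `Vf ≤ θ + ε`.
    · refine hin _ u hu huc.le _ (le_of_mul_le_mul_left ?_ hpos)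
      linarith
  refine le_of_forall_pos_le_add fun ε hε => ?_
  have hlam₂ : 0 < lam₂ := by linarith
  -- The two slack terms in `key` add up to `lam₂` times the slack, hence the division.
  have := key (ε / lam₂) (by positivity)
  have h : lam₂ * (ε / lam₂) = ε := by field_simp
  linarith

/-! ### Consequences of the assumptions near the reference -/

theorem X_mem_nhds (hyr : P.yr ∈ interior P.Y) (hur : P.ur ∈ interior P.U) :
    P.X ∈ 𝓝 P.xr := by
  have hy : ∀ i, ∀ᶠ x in 𝓝 P.xr, outputs x i ∈ P.Y := by
    intro i
    have hc : Continuous fun x : State ny nu na nb => outputs x i := by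
      unfold outputs
      fun_prop
    exact hc.continuousAt.eventually (mem_interior_iff_mem_nhds.1 hyr)
  have hu : ∀ i, ∀ᶠ x in 𝓝 P.xr, inputs x i ∈ P.U := by
    intro i
    have hc : Continuous fun x : State ny nu na nb => inputs x i := by
      unfold inputs
      fun_prop
    exact hc.continuousAt.eventually (mem_interior_iff_mem_nhds.1 hur)
  filter_upwards [eventually_all.2 hy, eventually_all.2 hu] with x h1 h2
  exact ⟨h1, h2⟩

theorem eventually_Vf_lt {ϑ : ℝ} (hΩ : P.Ω ϑ ∈ 𝓝 P.xr) (hterminal : P.TerminalCondition ϑ)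
    {ε : ℝ} (hε : 0 < ε) : ∀ᶠ x in 𝓝 P.xr, P.Vf (x - P.xr) < ε := by
  obtain ⟨α₁, α₂, -, hα₂, h⟩ := hterminal
  filter_upwards [hΩ, hα₂.1.eventually_lt P.xr hε] with x hx hlt
  rw [dist_eq_norm] at hlt
  exact (h x hx).2.1.trans_lt hlt

theorem Ω_mem_nhds {ϑ : ℝ} (hΩ : P.Ω ϑ ∈ 𝓝 P.xr) (hterminal : P.TerminalCondition ϑ) {θ : ℝ}
    (hθ : 0 < θ) : P.Ω θ ∈ 𝓝 P.xr :=
  (eventually_Vf_lt hΩ hterminal hθ).mono fun _ hx => hx.le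

theorem exists_levelPair (hyr : P.yr ∈ interior P.Y) (hur : P.ur ∈ interior P.U) {ϑ : ℝ}
    (hϑ : 0 < ϑ) (hΩ : P.Ω ϑ ∈ 𝓝 P.xr) (hterminal : P.TerminalCondition ϑ)
    (hstage : P.StageCostPosDef) : ∃ θ d : ℝ, P.LevelPair ϑ θ d := by
  have hnhds := fun {θ : ℝ} (hθ : 0 < θ) => Ω_mem_nhds hΩ hterminal hθ
  obtain ⟨α₁, α₂, hα₁, -, h⟩ := hterminal
  obtain ⟨-, α, hα, hαle⟩ := hstage
  obtain ⟨r, hr, hball⟩ := Metric.mem_nhds_iff.1 (X_mem_nhds hyr hur)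
  have hr' := hα₁.1.pos hr
  -- Halving turns the weak bound defining `Ω` into a strict one, which places `Ω` in the open ball
  -- of radius `r` inside `X`.
  have hθ : 0 < min ϑ (α₁ r / 2) := lt_min hϑ (half_pos hr')
  obtain ⟨ρ, hρ, hρball⟩ := Metric.mem_nhds_iff.1 (hnhds hθ)
  refine ⟨min ϑ (α₁ r / 2), α ρ, hθ, min_le_left _ _, ?_, hα.pos hρ, ?_⟩
  · intro x hx
    have hx' : P.Vf (x - P.xr) ≤ min ϑ (α₁ r / 2) := hx
    have h1 := (h x (hx'.trans (min_le_left _ _))).1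
    have h2 := hx'.trans (min_le_right _ _)
    apply hball
    rw [Metric.mem_ball, dist_eq_norm]
    exact hα₁.1.lt_of_lt (norm_nonneg _) hr.le (by linarith)
  · intro x hx u hu
    refine le_trans ?_ (hαle x hx.1 u hu)
    refine hα.2.1.monotoneOn (mem_Ici.2 hρ.le) (mem_Ici.2 (norm_nonneg _)) ?_
    by_contra hlt
    refine hx.2 (hρball ?_)
    rw [Metric.mem_ball, dist_eq_norm]
    exact not_le.1 hlt

theorem nonnegCosts {ϑ : ℝ} (hϑ : 0 < ϑ) (hterminal : P.TerminalCondition ϑ)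
    (hstage : P.StageCostPosDef) : P.NonnegCosts := by
  obtain ⟨α₁, α₂, hα₁, -, h⟩ := hterminal
  obtain ⟨-, α, hα, hαle⟩ := hstage
  refine ⟨fun x hx u hu => (hα.nonneg (norm_nonneg _)).trans (hαle x hx u hu), fun x => ?_⟩
  by_cases hx : x ∈ P.Ω ϑ
  · exact (hα₁.1.nonneg (norm_nonneg _)).trans (h x hx).1
  -- Outside `Ω ϑ` the terminal cost exceeds `ϑ` by definition, so the local bound yields global
  -- nonnegativity.
  · exact hϑ.le.trans (not_le.1 hx).le

/-- The barrier vanishes on `Ω θ ⊆ X`, so the tracking cost there is the whole stage cost. -/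
theorem terminalDecrease (hbarrier : P.IsBarrier) {ϑ θ : ℝ} (hθ : θ ≤ ϑ) (hX : P.Ω θ ⊆ P.X)
    (hterminal : P.TerminalCondition ϑ) : P.TerminalDecrease (P.Ω θ) := by
  obtain ⟨α₁, α₂, -, -, h⟩ := hterminal
  intro x hx
  obtain ⟨-, -, hdec, hU⟩ := h x (le_trans hx hθ)
  refine ⟨?_, hU⟩
  have hlb : P.lb (outputs x 0) = 0 := hbarrier.1 _ ((hX hx).1 0)
  rw [stageCost, hlb, terminalStep]
  linarith

/-! ### Asymptotic stability of the closed loop -/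

/-- The optimal value is the Lyapunov function; its smallness near `xr` comes from the bound by `lam
* Vf` on `Ω θ`, and its decrease keeps the region invariant. -/
theorem asymptoticallyStableOn_region (hNc : 1 ≤ P.Nc) (hNp : P.Nc ≤ P.Np) {θ d lam : ℝ}
    (hX : P.Ω θ ⊆ P.X) (hN : P.NonnegCosts) (hD : P.TerminalDecrease (P.Ω θ))
    (hsub : P.Ω θ ⊆ P.region θ d lam)
    (hend : ∀ x ∈ P.region θ d lam, ∀ u, P.IsOptimal lam x u → P.pred x u P.Np ∈ P.Ω θ)
    (hθ : P.Ω θ ∈ 𝓝 P.xr) (hVf : ∀ ε > 0, ∀ᶠ x in 𝓝 P.xr, P.Vf (x - P.xr) < ε)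
    (hstage : P.StageCostPosDef) (hlam : 1 ≤ lam) {κ : State ny nu na nb → Input nu}
    (hκ : P.IsMPCLawOn lam (P.region θ d lam) κ) :
    AsymptoticallyStableOn (fun x => P.F x (κ x)) P.xr (P.region θ d lam) := by
  obtain ⟨-, α, hα, hαle⟩ := hstage
  have hNp1 : 1 ≤ P.Np := hNc.trans hNp
  have hstep : ∀ x ∈ P.region θ d lam, (P.admissible (P.F x (κ x))).Nonempty ∧
      P.value lam (P.F x (κ x)) + α ‖x - P.xr‖ ≤ P.value lam x := by
    intro x hx
    obtain ⟨u, hu, hux⟩ := hκ x hx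
    obtain ⟨hne, hle⟩ := value_F_le hNp hX hN hD hlam hu (hend x hx u hu)
    have h0 := hu.1 0 hNp1
    have h1 := hαle _ h0.1 _ h0.2
    simp only [pred] at h1
    rw [hux]
    exact ⟨hne, by linarith⟩
  refine asymptoticallyStableOn_of_lyapunov (mem_of_superset hθ hsub) ?_ (V := P.value lam) hα
    ?_ ?_ ?_
  · intro x hx
    obtain ⟨hne, hle⟩ := hstep x hx
    exact ⟨hne, by linarith [hx.2, hα.nonneg (norm_nonneg (x - P.xr))]⟩
  · intro x hx
    rw [dist_eq_norm]
    exact le_value hNp1 hN hαle hlam hx.1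
  · intro x hx
    rw [dist_eq_norm]
    exact (hstep x hx).2
  · intro ε hε
    have hpos : 0 < lam := by linarith
    filter_upwards [hθ, hVf (ε / lam) (by positivity)] with x hx hlt
    refine (value_le_of_mem_Ω hX hN hD hlam hx).2.trans_lt ?_
    rw [lt_div_iff₀ hpos] at hlt
    linarith

end Problem

end NarxMPC

theorem theorem3 {ny nu na nb : ℕ} (P : NarxMPC.Problem ny nu na nb) (ϑ : ℝ)
    (hNc : 1 ≤ P.Nc) (hNp : P.Nc ≤ P.Np)
    (hyr : P.yr ∈ interior P.Y) (hur : P.ur ∈ interior P.U)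
    (hbarrier : P.IsBarrier)
    (hϑ : 0 < ϑ) (hΩ : P.Ω ϑ ∈ 𝓝 P.xr)
    (hterminal : P.TerminalCondition ϑ)
    (hstage : P.StageCostPosDef) :
    (∃ θ d : ℝ, P.LevelPair ϑ θ d) ∧
    ∀ θ d : ℝ, P.LevelPair ϑ θ d →
      (∀ lam : ℝ, 1 ≤ lam →
        P.Ω θ ⊆ P.region θ d lam ∧
        (∀ x ∈ P.region θ d lam, ∀ u, P.IsOptimal lam x u → P.pred x u P.Np ∈ P.Ω θ) ∧
        ∀ κ : NarxMPC.State ny nu na nb → NarxMPC.Input nu,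
          P.IsMPCLawOn lam (P.region θ d lam) κ →
          NarxMPC.AsymptoticallyStableOn (fun x => P.F x (κ x)) P.xr (P.region θ d lam)) ∧
      ∀ lam₁ lam₂ : ℝ, 1 ≤ lam₁ → lam₁ ≤ lam₂ →
        P.region θ d lam₁ ⊆ P.region θ d lam₂ := by
  refine ⟨NarxMPC.Problem.exists_levelPair hyr hur hϑ hΩ hterminal hstage, ?_⟩
  rintro θ d ⟨hθ, hθϑ, hX, hd, hdle⟩
  have hN := NarxMPC.Problem.nonnegCosts hϑ hterminal hstage
  have hD := NarxMPC.Problem.terminalDecrease hbarrier hθϑ hX hterminal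
  refine ⟨fun lam hlam => ?_, fun lam₁ lam₂ h₁ h₁₂ =>
    NarxMPC.Problem.region_mono hX hN hD hdle h₁ h₁₂⟩
  have hsub : P.Ω θ ⊆ P.region θ d lam := by
    intro x hx
    obtain ⟨hne, hle⟩ := NarxMPC.Problem.value_le_of_mem_Ω hX hN hD hlam hx
    have h1 : lam * P.Vf (x - P.xr) ≤ lam * θ := mul_le_mul_of_nonneg_left hx (by linarith)
    have h2 : 0 ≤ P.Np * d := by positivity
    exact ⟨hne, by linarith⟩
  have hend : ∀ x ∈ P.region θ d lam, ∀ u, P.IsOptimal lam x u → P.pred x u P.Np ∈ P.Ω θ :=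
    fun x hx u hu => NarxMPC.Problem.mem_Ω_of_isOptimal hX hN hD hdle hlam hx hu
  exact ⟨hsub, hend, fun κ hκ => NarxMPC.Problem.asymptoticallyStableOn_region hNc hNp hX hN hD
    hsub hend (NarxMPC.Problem.Ω_mem_nhds hΩ hterminal hθ)
    (fun ε hε => NarxMPC.Problem.eventually_Vf_lt hΩ hterminal hε) hstage hlam hκ⟩
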